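/- Let $M_0 \xleftarrow{p_0} M_1 \xleftarrow{p_1} M_2 \leftarrow\cdots$ be a sequence of closed connected topological manifolds and non-injective covering maps $p_i\colon M_{i+1}\to M_i$, such that every composition $p^j_i=p_i\circ\cdots\circ p_{j-1}\colon M_j\to M_i$ ($i\le j$, $p^i_i=\mathrm{id}$) is a regular covering, i.e. its deck transformations act transitively on each fiber. Choose base-points $m_i\in M_i$ with $p_i(m_{i+1})=m_i$. Let $M_\infty=\varprojlim(M_i,p_i)\subset\prod_i M_i$ be the solenoid, with projections $\pi_i\colon M_\infty\to M_i$ and base-point $m_\infty=(m_i)$. A (base-point preserving) bundle morphism from $\pi_j$ to $\pi_i$ is a pair of continuous maps $h_1\colon M_\infty\to M_\infty$ (the lifted map) and $f_1\colon M_j\to M_i$ (the base-map) with $\pi_i\circ h_1=f_1\circ\pi_j$ and $h_1(m_\infty)=m_\infty$. It is called an automorphism of $M_\infty$ if there are an index $k\le j$ and a bundle morphism $(h_2,f_2)$ from $\pi_i$ to $\pi_k$ such that $f_2\circ f_1\colon M_j\to M_k$ is homotopic, relative to the base-point $m_j$, to the covering projection $p^j_k$. Theorem. Let $h\colon M_\infty\to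 M_\infty$ be a homeomorphism with $h(m_\infty)=m_\infty$. Then there are indices $j,i$ and an automorphism $(h_1,f_1)$ of $M_\infty$, from $\pi_j$ to $\pi_i$, such that $h$ is homotopic to $h_1$ relative to the base-point $m_\infty$. -/

import Mathlib

universe u

/-- A closed connected topological manifold of dimension `n`: a nonempty connected compact
Hausdorff space that is locally homeomorphic to `ℝⁿ`. (Second countability is automatic.) -/
structure IsClosedConnectedManifold (n : ℕ) (X : Type u) [TopologicalSpace X] : Prop where
  t2 : T2Space X
  compact : CompactSpace X
  connected : ConnectedSpace X
  locallyEuclidean : Nonempty (ChartedSpace (EuclideanSpace ℝ (Fin n)) X)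

/-- A covering map is regular if its deck transformations act transitively on every fiber. -/
def IsRegularCovering {E B : Type u} [TopologicalSpace E] [TopologicalSpace B]
    (p : E → B) : Prop :=
  IsCoveringMap p ∧ ∀ x y : E, p x = p y → ∃ φ : E ≃ₜ E, (∀ z, p (φ z) = p z) ∧ φ x = y

/-- The composition `p^j_i : M_j → M_i` of the maps `p_i, …, p_{j-1}`, for `i ≤ j`. -/
def bondingComp {M : ℕ → Type u} [∀ i, TopologicalSpace (M i)] (p : ∀ i, C(M (i + 1), M i))
    {i j : ℕ} (hij : i ≤ j) : C(M j, M i) :=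
  Nat.leRecOn (C := fun k => C(M k, M i)) hij (fun {k} f => f.comp (p k)) (ContinuousMap.id (M i))

/-- The data of a pointed (strong) solenoid: closed connected manifolds `M_i` of dimension `dim`,
bonding maps `p_i : M_{i+1} → M_i` that are non-injective coverings, all of whose compositions
are regular coverings, and a compatible sequence of base-points. -/
structure Solenoid where
  dim : ℕ
  M : ℕ → Type u
  [top : ∀ i, TopologicalSpace (M i)]
  manifold : ∀ i, IsClosedConnectedManifold dim (M i)
  p : ∀ i, C(M (i + 1), M i)
  covering : ∀ i, IsCoveringMap (p i)
  not_injective : ∀ i, ¬ Function.Injective (p i)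
  regular : ∀ (i j : ℕ) (hij : i ≤ j), IsRegularCovering (bondingComp p hij)
  m : ∀ i, M i
  p_m : ∀ i, p i (m (i + 1)) = m i

attribute [instance] Solenoid.top

namespace Solenoid

/-- The inverse limit `M_∞`, a subspace of the product of the factor spaces. -/
abbrev Limit (S : Solenoid.{u}) : Type u :=
  {x : ∀ i, S.M i // ∀ i, S.p i (x (i + 1)) = x i}

/-- The base-point `m_∞ = (m_i)` of `M_∞`. -/
def basePoint (S : Solenoid.{u}) : S.Limit := ⟨S.m, S.p_m⟩

/-- The projection `π_i : M_∞ → M_i`. -/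
def proj (S : Solenoid.{u}) (i : ℕ) : C(S.Limit, S.M i) where
  toFun x := x.1 i
  continuous_toFun := (continuous_apply i).comp continuous_subtype_val

/-- The covering projection `p^j_i : M_j → M_i`. -/
def bond (S : Solenoid.{u}) {i j : ℕ} (hij : i ≤ j) : C(S.M j, S.M i) :=
  bondingComp S.p hij

/-- A base-point preserving bundle morphism from `π_j : M_∞ → M_j` to `π_i : M_∞ → M_i`,
with lifted map `lift` and base-map `base`. -/
structure BundleMorphism (S : Solenoid.{u}) (j i : ℕ) where
  lift : C(S.Limit, S.Limit)
  base : C(S.M j, S.M i)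
  comm : (S.proj i).comp lift = base.comp (S.proj j)
  lift_basePoint : lift S.basePoint = S.basePoint

/-- The morphism `(h₁, f₁)` from `π_j` to `π_i` is an automorphism if there is a morphism
`(h₂, f₂)` from `π_i` to some `π_k`, `k ≤ j`, such that `f₂ ∘ f₁` is homotopic to `p^j_k`
(relative to the base-point). -/
def BundleMorphism.IsAutomorphism {S : Solenoid.{u}} {j i : ℕ} (F : S.BundleMorphism j i) :
    Prop :=
  ∃ (k : ℕ) (hkj : k ≤ j) (G : S.BundleMorphism i k),
    ContinuousMap.HomotopicRel (G.base.comp F.base) (S.bond hkj) {S.m j}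

end Solenoid

/-! Up to homotopy, maps on the solenoid live on finite stages. Each `M_i` is a Euclidean
neighbourhood retract, and by Stone–Weierstrass an `ℝ^ι`-valued map on `M_∞` or `I × M_∞` is close
to one factoring through a stage. Retracting segments back to `M_i` turns closeness into homotopy:
maps to `M_i` factor through a stage (`exists_homotopicRel_comp_proj`), and homotopies descend to a
later one (`exists_homotopicRel_comp_bond`). Lifting homotopies up the tower of coverings makes
every pointed self-map homotopic to a bundle morphism onto a prescribed `π_i`
(`exists_bundleMorphism`). Apply this to `h⁻¹` over `π_0`, giving `G` from `π_i`, then to `h` over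
that `π_i`, giving `F` from `π_j`. The composite of base-maps agrees with `p^j_0` up to homotopy
after composing with `π_j`, hence at some later stage. -/

open Set Metric Topology

/-! ### Compact manifolds as Euclidean neighbourhood retracts -/

/-- A map into a space with finitely many Tietze charts, continuous on a closed set `A` of a normal
space, extends over a neighbourhood of the part of `A` that is sent to given closed subsets of the
chart domains. -/
theorem exists_continuousOn_extension_of_charts {X : Type u} {Y E ι : Type*}
    [TopologicalSpace X] [NormalSpace X] [TopologicalSpace Y] [TopologicalSpace E]
    [TietzeExtension.{u} E]
    (c : ι → OpenPartialHomeomorph Y E) {K : ι → Set Y} (hK : ∀ i, IsClosed (K i))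
    (hKc : ∀ i, K i ⊆ (c i).source) {A : Set X} (hA : IsClosed A) {f : X → Y}
    (hf : ContinuousOn f A) (s : Finset ι) :
    ∃ (C : Set X) (g : X → Y), IsClosed C ∧ A ⊆ C ∧ ContinuousOn g C ∧ EqOn g f A ∧
      ∀ i ∈ s, A ∩ f ⁻¹' K i ⊆ interior C := by
  classical
  induction s using Finset.induction_on with
  | empty => exact ⟨A, f, hA, Subset.rfl, hf, fun _ _ => rfl, by simp⟩
  | insert i s _ ih =>
    obtain ⟨C, g, hC, hAC, hg, hgf, hs⟩ := ih
    have hAi : IsClosed (A ∩ f ⁻¹' K i) := hf.preimage_isClosed_of_isClosed hA (hK i)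
    have hB : IsClosed (C ∩ g ⁻¹' (c i).sourceᶜ) :=
      hg.preimage_isClosed_of_isClosed hC (c i).open_source.isClosed_compl
    obtain ⟨u, hu, hAu, huB⟩ := normal_exists_closure_subset hAi hB.isOpen_compl (by
      rintro x ⟨hxA, hxK⟩ ⟨-, hx⟩
      exact hx (by rw [hgf hxA]; exact hKc i hxK))
    have hT : IsClosed (closure u ∩ C) := isClosed_closure.inter hC
    have hTs : MapsTo g (closure u ∩ C) (c i).source := fun x hx => by
      by_contra h
      exact huB hx.1 ⟨hx.2, h⟩
    have hcg : ContinuousOn (c i ∘ g) (closure u ∩ C) :=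
      (c i).continuousOn.comp (hg.mono inter_subset_right) hTs
    -- Tietze extends the chart expression of `g`. Its values may leave the chart target, hence the
    -- second shrinking, from `u` to `v`.
    obtain ⟨G, hG⟩ := ContinuousMap.exists_restrict_eq hT ⟨_, hcg.domRestrict⟩
    have hG' : ∀ x ∈ closure u ∩ C, G x = c i (g x) := fun x hx =>
      DFunLike.congr_fun hG ⟨x, hx⟩
    have hO : IsOpen (G ⁻¹' (c i).target) := (c i).open_target.preimage G.continuous
    obtain ⟨v, hv, hAv, hvu⟩ := normal_exists_closure_subset hAi (hu.inter hO) (by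
      intro x hx
      refine ⟨hAu hx, ?_⟩
      have hxT : x ∈ closure u ∩ C := ⟨subset_closure (hAu hx), hAC hx.1⟩
      rw [mem_preimage, hG' x hxT]
      exact (c i).map_source (hTs hxT))
    have hg'C : EqOn (C.piecewise g ((c i).symm ∘ G)) g C := piecewise_eqOn _ _ _
    have hg'v : EqOn (C.piecewise g ((c i).symm ∘ G)) ((c i).symm ∘ G) (closure v) := by
      intro x hx
      by_cases hxC : x ∈ C
      · have hxT : x ∈ closure u ∩ C := ⟨subset_closure (hvu hx).1, hxC⟩
        rw [piecewise_eq_of_mem _ _ _ hxC, Function.comp_apply, hG' x hxT,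
          (c i).left_inv (hTs hxT)]
      · exact piecewise_eq_of_notMem _ _ _ hxC
    refine ⟨C ∪ closure v, C.piecewise g ((c i).symm ∘ G), hC.union isClosed_closure,
      hAC.trans subset_union_left, ?_, fun x hx => (hg'C (hAC hx)).trans (hgf hx), ?_⟩
    · refine ContinuousOn.union_of_isClosed (hg.congr hg'C) (ContinuousOn.congr ?_ hg'v) hC
        isClosed_closure
      exact (c i).continuousOn_symm.comp G.continuous.continuousOn fun x hx => (hvu hx).2
    · intro k hk
      rcases Finset.mem_insert.1 hk with rfl | hk
      · exact hAv.trans (interior_maximal (subset_closure.trans subset_union_right) hv)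
      · exact (hs k hk).trans (interior_mono subset_union_left)

/-- A compact Hausdorff manifold is covered by closed subsets of finitely many chart domains. -/
theorem exists_finite_charts_closed_cover {n : ℕ} {Y : Type u} [TopologicalSpace Y]
    [CompactSpace Y] [T2Space Y] [ChartedSpace (EuclideanSpace ℝ (Fin n)) Y] :
    ∃ (t : Finset Y) (K : t → Set Y), (∀ i, IsClosed (K i)) ∧ (⋃ i, K i) = univ ∧
      ∀ i : t, K i ⊆ (chartAt (EuclideanSpace ℝ (Fin n)) (i : Y)).source := by
  obtain ⟨t, ht⟩ := isCompact_univ.elim_finite_subcover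
    (fun y : Y => (chartAt (EuclideanSpace ℝ (Fin n)) y).source)
    (fun y => (chartAt _ y).open_source) (fun y _ => mem_iUnion.2 ⟨y, mem_chart_source _ y⟩)
  obtain ⟨K, hKu, hK, hKs⟩ := exists_iUnion_eq_closed_subset
    (u := fun i : t => (chartAt (EuclideanSpace ℝ (Fin n)) (i : Y)).source)
    (fun i => (chartAt _ _).open_source) (fun _ => toFinite _) (by
      rw [eq_univ_iff_forall]
      intro y
      obtain ⟨i, hi, hy⟩ := mem_iUnion₂.1 (ht (mem_univ y))
      exact mem_iUnion.2 ⟨⟨i, hi⟩, hy⟩)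
  exact ⟨t, K, hK, hKu, hKs⟩

/-- A compact Hausdorff topological manifold embeds into some `ℝ^ι` with `ι` finite. -/
theorem exists_injective_continuousMap_pi_real {n : ℕ} {Y : Type u} [TopologicalSpace Y]
    [CompactSpace Y] [T2Space Y] [ChartedSpace (EuclideanSpace ℝ (Fin n)) Y] :
    ∃ (ι : Type u) (_ : Fintype ι) (e : C(Y, ι → ℝ)), Function.Injective e := by
  obtain ⟨t, K, hK, hKu, hKs⟩ := exists_finite_charts_closed_cover (n := n) (Y := Y)
  have hbump : ∀ i : t, ∃ l : C(Y, ℝ), tsupport l ⊆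
      (chartAt (EuclideanSpace ℝ (Fin n)) (i : Y)).source ∧ EqOn l 1 (K i) := fun i => by
    obtain ⟨v, hv, hKv, hvs⟩ := normal_exists_closure_subset (hK i) (chartAt _ _).open_source
      (hKs i)
    obtain ⟨l, hl0, hl1, -⟩ := exists_continuous_zero_one_of_isClosed hv.isClosed_compl (hK i)
      (disjoint_left.2 fun x hx hxK => hx (hKv hxK))
    refine ⟨l, (closure_mono fun x hx => ?_).trans hvs, hl1⟩
    by_contra h
    exact hx (hl0 h)
  choose l hl hl1 using hbump
  have hcont : ∀ (i : t) (a : Fin n), Continuous fun y =>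
      l i y * chartAt (EuclideanSpace ℝ (Fin n)) (i : Y) y a := fun i a => by
    refine continuous_of_tsupport fun y hy => ?_
    have hy' := hl i (closure_mono (Function.support_mul_subset_left _ _) hy)
    have h1 : ContinuousAt (chartAt (EuclideanSpace ℝ (Fin n)) (i : Y)) y :=
      (chartAt _ _).continuousAt hy'
    have h2 : Continuous fun z : EuclideanSpace ℝ (Fin n) => z a := by fun_prop
    exact (l i).continuous.continuousAt.mul
      (ContinuousAt.comp (f := chartAt (EuclideanSpace ℝ (Fin n)) (i : Y)) h2.continuousAt h1)
  -- The `none` coordinate is the bump itself: where it equals 1 the point lies in the chart domain,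
  -- and the `some a` coordinates are the chart's.
  refine ⟨t × Option (Fin n), inferInstance, ⟨fun y k => k.2.elim (l k.1 y) fun a =>
    l k.1 y * chartAt (EuclideanSpace ℝ (Fin n)) (k.1 : Y) y a, continuous_pi ?_⟩, ?_⟩
  · rintro ⟨i, _ | a⟩
    · exact (l i).continuous
    · exact hcont i a
  · intro y z hyz
    obtain ⟨i, hi⟩ := mem_iUnion.1 (hKu ▸ mem_univ y)
    have hly : l i y = 1 := hl1 i hi
    have hlz : l i z = 1 := (congr_fun hyz (i, none)).symm.trans hly
    have hz : z ∈ (chartAt (EuclideanSpace ℝ (Fin n)) (i : Y)).source :=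
      hl i (subset_closure (by simp [hlz]))
    refine (chartAt (EuclideanSpace ℝ (Fin n)) (i : Y)).injOn (hKs i hi) hz ?_
    ext a
    have := congr_fun hyz (i, some a)
    simpa [hly, hlz] using this

/-- A compact Hausdorff topological manifold is a Euclidean neighbourhood retract. -/
theorem exists_embedding_retraction_thickening {n : ℕ} {Y : Type u} [TopologicalSpace Y]
    [CompactSpace Y] [T2Space Y] [Nonempty Y] [ChartedSpace (EuclideanSpace ℝ (Fin n)) Y] :
    ∃ (ι : Type u) (_ : Fintype ι) (e : C(Y, ι → ℝ)) (r : (ι → ℝ) → Y) (δ : ℝ), 0 < δ ∧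
      (∀ y, r (e y) = y) ∧ ContinuousOn r (thickening δ (range e)) := by
  obtain ⟨ι, _, e, he⟩ := exists_injective_continuousMap_pi_real (n := n) (Y := Y)
  obtain ⟨t, K, hK, hKu, hKs⟩ := exists_finite_charts_closed_cover (n := n) (Y := Y)
  have hemb : IsClosedEmbedding e := e.continuous.isClosedEmbedding he
  have hinv : ContinuousOn (Function.invFun e) (range e) := by
    rw [continuousOn_iff_continuous_domRestrict]
    convert! hemb.isEmbedding.toHomeomorph.symm.continuous using 1
  obtain ⟨C, r, -, -, hr, hre, hC⟩ := exists_continuousOn_extension_of_charts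
    (fun i : t => chartAt (EuclideanSpace ℝ (Fin n)) (i : Y)) hK hKs hemb.isClosed_range hinv
    Finset.univ
  have hsub : range e ⊆ interior C := by
    rintro _ ⟨y, rfl⟩
    obtain ⟨i, hi⟩ := mem_iUnion.1 (hKu ▸ mem_univ y)
    refine hC i (Finset.mem_univ i) ⟨⟨y, rfl⟩, ?_⟩
    rwa [mem_preimage, Function.leftInverse_invFun he y]
  obtain ⟨δ, hδ, hδC⟩ := (isCompact_range e.continuous).exists_thickening_subset_open
    isOpen_interior hsub
  exact ⟨ι, inferInstance, e, r, δ, hδ,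
    fun y => (hre ⟨y, rfl⟩).trans (Function.leftInverse_invFun he y),
    hr.mono (hδC.trans interior_subset)⟩

open scoped unitInterval

/-! ### Approximation on inverse limits -/

/-- Continuous vector-valued functions on an inverse limit of normal Hausdorff spaces are uniformly
approximated by functions that factor through a stage of the system. -/
theorem exists_approx_factor_of_separating {X : Type*} [TopologicalSpace X] [CompactSpace X]
    {Z : ℕ → Type*} [∀ j, TopologicalSpace (Z j)] [∀ j, NormalSpace (Z j)] [∀ j, T1Space (Z j)]
    (q : ∀ j, C(X, Z j)) (b : ∀ {i j : ℕ}, i ≤ j → C(Z j, Z i))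
    (hb : ∀ {i j : ℕ} (hij : i ≤ j), (b hij).comp (q j) = q i)
    (hq : ∀ x y, (∀ j, q j x = q j y) → x = y) {ι : Type*} [Fintype ι] (u : C(X, ι → ℝ))
    {ε : ℝ} (hε : 0 < ε) :
    ∃ j₀, ∀ j ≥ j₀, ∃ v : C(Z j, ι → ℝ), ∀ x, dist (v (q j x)) (u x) < ε := by
  -- Functions factoring through stage `j`. These subalgebras increase and their union separates
  -- points, so Stone–Weierstrass applies.
  let A : ℕ → Subalgebra ℝ C(X, ℝ) := fun j => (ContinuousMap.compRightAlgHom ℝ ℝ (q j)).range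
  have hmono : Monotone A := by
    rintro i j hij _ ⟨w, rfl⟩
    refine ⟨w.comp (b hij), ?_⟩
    change (w.comp (b hij)).comp (q j) = w.comp (q i)
    rw [ContinuousMap.comp_assoc, hb]
  have hsep : (⨆ j, A j).SeparatesPoints := by
    intro x y hxy
    obtain ⟨j, hj⟩ : ∃ j, q j x ≠ q j y := by
      by_contra! h
      exact hxy (hq x y h)
    obtain ⟨w, hw0, hw1, -⟩ := exists_continuous_zero_one_of_isClosed
      (isClosed_singleton (x := q j x)) (isClosed_singleton (x := q j y))
      (disjoint_singleton.2 hj)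
    refine ⟨w.comp (q j), ⟨w.comp (q j), le_iSup A j ⟨w, rfl⟩, rfl⟩, ?_⟩
    have h0 : w (q j x) = 0 := hw0 rfl
    have h1 : w (q j y) = 1 := hw1 rfl
    simp [h0, h1]
  have hcoord : ∀ k : ι, ∃ j, ∃ w : C(Z j, ℝ), ∀ x, dist (w (q j x)) (u x k) < ε := fun k => by
    obtain ⟨⟨g, hg⟩, hgu⟩ :=
      ContinuousMap.exists_mem_subalgebra_near_continuous_of_separatesPoints _ hsep
        (fun x => u x k) ((continuous_apply k).comp u.continuous) ε hε
    rw [← SetLike.mem_coe, Subalgebra.coe_iSup_of_directed hmono.directed_le, mem_iUnion] at hg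
    obtain ⟨j, w, rfl⟩ := hg
    exact ⟨j, w, fun x => hgu x⟩
  choose J w hw using hcoord
  refine ⟨Finset.univ.sup J, fun j hj => ?_⟩
  have hJ : ∀ k, J k ≤ j := fun k => (Finset.le_sup (Finset.mem_univ k)).trans hj
  refine ⟨ContinuousMap.pi fun k => (w k).comp (b (hJ k)), fun x => ?_⟩
  rw [dist_pi_lt_iff hε]
  intro k
  have : b (hJ k) (q j x) = q (J k) x := DFunLike.congr_fun (hb (hJ k)) x
  simpa [this] using hw k x

namespace Solenoid

/-! ### The tower of coverings and its limit -/

variable (S : Solenoid.{u})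

theorem bond_self (i : ℕ) : S.bond (le_refl i) = ContinuousMap.id (S.M i) :=
  Nat.leRecOn_self (C := fun k => C(S.M k, S.M i)) _

theorem bond_succ {i j : ℕ} (hij : i ≤ j) :
    S.bond (hij.trans j.le_succ) = (S.bond hij).comp (S.p j) :=
  Nat.leRecOn_succ hij _

theorem bond_comp_proj {i j : ℕ} (hij : i ≤ j) : (S.bond hij).comp (S.proj j) = S.proj i := by
  induction j, hij using Nat.le_induction with
  | base => rw [bond_self, ContinuousMap.id_comp]
  | succ j hij ih =>
    rw [bond_succ _ hij, ContinuousMap.comp_assoc, ← ih]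
    congr 1
    ext x
    exact x.2 j

theorem bond_succ_left {i j : ℕ} (hij : i + 1 ≤ j) (x : S.M j) :
    S.p i (S.bond hij x) = S.bond (i.le_succ.trans hij) x := by
  induction j, hij using Nat.le_induction with
  | base => rw [bond_self, bond_succ _ le_rfl, bond_self]; rfl
  | succ j hij ih =>
    rw [bond_succ _ hij, bond_succ _ (i.le_succ.trans hij)]
    exact ih _

theorem bond_m {i j : ℕ} (hij : i ≤ j) : S.bond hij (S.m j) = S.m i :=
  DFunLike.congr_fun (S.bond_comp_proj hij) S.basePoint

/-- The point of the inverse limit determined by its coordinates from `i` on. -/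
def ofTail (i : ℕ) (y : ∀ k, S.M (i + k)) (hy : ∀ k, S.p (i + k) (y (k + 1)) = y k) : S.Limit :=
  -- Pushing `y k` down from stage `i + k` to stage `k` avoids splitting on `k < i`.
  ⟨fun k => S.bond (Nat.le_add_left k i) (y k), fun k => by
    rw [bond_succ_left]
    dsimp only
    rw [← hy k]
    exact DFunLike.congr_fun (S.bond_succ (Nat.le_add_left k i)) (y (k + 1))⟩

theorem bond_tail {i : ℕ} {y : ∀ k, S.M (i + k)} (hy : ∀ k, S.p (i + k) (y (k + 1)) = y k)
    (k : ℕ) : S.bond (Nat.le_add_right i k) (y k) = y 0 := by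
  induction k with
  | zero => exact DFunLike.congr_fun (S.bond_self i) (y 0)
  | succ k ih =>
    rw [← ih, ← hy k]
    exact DFunLike.congr_fun (S.bond_succ (Nat.le_add_right i k)) (y (k + 1))

theorem ofTail_apply_self {i : ℕ} {y : ∀ k, S.M (i + k)}
    (hy : ∀ k, S.p (i + k) (y (k + 1)) = y k) : (S.ofTail i y hy).1 i = y 0 :=
  S.bond_tail hy i

/-- A point of the inverse limit is recovered from its coordinates from `i` on. -/
theorem ofTail_eq {i : ℕ} {y : ∀ k, S.M (i + k)} (hy : ∀ k, S.p (i + k) (y (k + 1)) = y k)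
    (x : S.Limit) (hx : ∀ k, y k = x.1 (i + k)) : S.ofTail i y hy = x := by
  ext k
  change S.bond (Nat.le_add_left k i) (y k) = x.1 k
  rw [hx]
  exact DFunLike.congr_fun (S.bond_comp_proj (Nat.le_add_left k i)) x

instance (i : ℕ) : CompactSpace (S.M i) := (S.manifold i).compact
instance (i : ℕ) : T2Space (S.M i) := (S.manifold i).t2
instance (i : ℕ) : ConnectedSpace (S.M i) := (S.manifold i).connected

instance : CompactSpace S.Limit := by
  suffices h : IsClosed {x : ∀ i, S.M i | ∀ i, S.p i (x (i + 1)) = x i} from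
    isCompact_iff_compactSpace.1 h.isCompact
  rw [show {x : ∀ i, S.M i | ∀ i, S.p i (x (i + 1)) = x i} =
    ⋂ i, {x | S.p i (x (i + 1)) = x i} by ext; simp]
  exact isClosed_iInter fun i => isClosed_eq
    ((S.p i).continuous.comp (continuous_apply _)) (continuous_apply _)

theorem p_surjective (i : ℕ) : Function.Surjective (S.p i) := by
  rw [← range_eq_univ]
  exact IsClopen.eq_univ ⟨(isCompact_range (S.p i).continuous).isClosed,
    (S.covering i).isOpenMap.isOpen_range⟩ (range_nonempty _)

/-- Preimages are chosen successively up the tower. This carries estimates made on the limit over to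
every point of a stage. -/
theorem proj_surjective (i : ℕ) : Function.Surjective (S.proj i) := by
  intro z
  choose s hs using S.p_surjective
  let y : ∀ k, S.M (i + k) := fun k => Nat.rec (motive := fun k => S.M (i + k)) z
    (fun k w => s (i + k) w) k
  have hy : ∀ k, S.p (i + k) (y (k + 1)) = y k := fun k => hs _ _
  exact ⟨S.ofTail i y hy, S.ofTail_apply_self hy⟩

/-! ### Descending maps and homotopies to finite stages -/

theorem exists_embedding_retraction (i : ℕ) :
    ∃ (ι : Type u) (_ : Fintype ι) (e : C(S.M i, ι → ℝ)) (r : (ι → ℝ) → S.M i) (δ : ℝ), 0 < δ ∧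
      (∀ y, r (e y) = y) ∧ ContinuousOn r (thickening δ (range e)) := by
  obtain ⟨_⟩ := (S.manifold i).locallyEuclidean
  exact exists_embedding_retraction_thickening (n := S.dim)

/-- A map from the solenoid to a factor space factors, up to homotopy relative to the base-point,
through a projection. -/
theorem exists_homotopicRel_comp_proj {i : ℕ} (f : C(S.Limit, S.M i)) :
    ∃ (j : ℕ) (g : C(S.M j, S.M i)),
      ContinuousMap.HomotopicRel f (g.comp (S.proj j)) {S.basePoint} := by
  obtain ⟨ι, _, e, r, δ, hδ, hre, hr⟩ := S.exists_embedding_retraction i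
  obtain ⟨j, hj⟩ := exists_approx_factor_of_separating S.proj S.bond S.bond_comp_proj
    (fun x y h => Subtype.ext (funext h)) (e.comp f) (half_pos hδ)
  obtain ⟨v, hv⟩ := hj j le_rfl
  -- A constant shift makes the base-point value exact, so the segment homotopy is relative; it
  -- costs a second `δ / 2`.
  let w : C(S.M j, ι → ℝ) :=
    v + ContinuousMap.const _ (e (f S.basePoint) - v (S.m j))
  have hwm : w (S.m j) = e (f S.basePoint) := by simp [w]
  have hw : ∀ x, ‖w (S.proj j x) - e (f x)‖ < δ := fun x => by
    have h1 := hv x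
    have h2 := hv S.basePoint
    rw [dist_eq_norm] at h1
    rw [dist_comm, dist_eq_norm] at h2
    calc ‖w (S.proj j x) - e (f x)‖
        = ‖(v (S.proj j x) - e (f x)) + (e (f S.basePoint) - v (S.m j))‖ := by
          congr 1; simp only [w, ContinuousMap.add_apply, ContinuousMap.const_apply]; abel
      _ ≤ _ := norm_add_le _ _
      _ < δ / 2 + δ / 2 := add_lt_add h1 h2
      _ = δ := add_halves δ
  have hmem : ∀ z ∈ I, ∀ x, e (f x) + z • (w (S.proj j x) - e (f x)) ∈ thickening δ (range e) :=
    fun z hz x => by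
      refine mem_thickening_iff.2 ⟨e (f x), ⟨f x, rfl⟩, ?_⟩
      rw [dist_eq_norm, add_sub_cancel_left, norm_smul, Real.norm_of_nonneg hz.1]
      exact (mul_le_of_le_one_left (norm_nonneg _) hz.2).trans_lt (hw x)
  have hwr : ∀ y, w y ∈ thickening δ (range e) := fun y => by
    obtain ⟨x, rfl⟩ := S.proj_surjective j y
    simpa using hmem 1 (by simp) x
  refine ⟨j, ⟨r ∘ w, hr.comp_continuous w.continuous hwr⟩, ⟨⟨⟨⟨fun tx =>
    r (e (f tx.2) + (tx.1 : ℝ) • (w (S.proj j tx.2) - e (f tx.2))), ?_⟩, ?_, ?_⟩, ?_⟩⟩⟩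
  · exact hr.comp_continuous (by fun_prop) fun tx => hmem _ tx.1.2 _
  · intro x
    simp [hre]
  · intro x
    simp
  · rintro t x rfl
    have : w (S.proj j S.basePoint) = e (f S.basePoint) := hwm
    simp [this, hre]

/-- Two maps between factor spaces that become homotopic on the solenoid are already homotopic
at some later stage. -/
theorem exists_homotopicRel_comp_bond {i j : ℕ} {g₀ g₁ : C(S.M j, S.M i)}
    (hg : ContinuousMap.HomotopicRel (g₀.comp (S.proj j)) (g₁.comp (S.proj j)) {S.basePoint}) :
    ∃ (k : ℕ) (hjk : j ≤ k),
      ContinuousMap.HomotopicRel (g₀.comp (S.bond hjk)) (g₁.comp (S.bond hjk)) {S.m k} := by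
  obtain ⟨H⟩ := hg
  obtain ⟨ι, _, e, r, δ, hδ, hre, hr⟩ := S.exists_embedding_retraction i
  obtain ⟨k₀, hk₀⟩ := exists_approx_factor_of_separating
    (fun j => (ContinuousMap.id I).prodMap (S.proj j))
    (fun hij => (ContinuousMap.id I).prodMap (S.bond hij))
    (fun hij => by
      ext1 tx
      exact Prod.ext rfl (DFunLike.congr_fun (S.bond_comp_proj hij) tx.2))
    (fun x y h => Prod.ext (Prod.ext_iff.1 (h 0)).1
      (Subtype.ext (funext fun j => (Prod.ext_iff.1 (h j)).2)))
    -- The base-point correction doubles the error to `δ / 3`, and the endpoint correction adds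
    -- another `δ / 3`, which stays below `δ`.
    (e.comp H.toContinuousMap) (ε := δ / 6) (by positivity)
  have hjk : j ≤ max j k₀ := le_max_left _ _
  obtain ⟨v, hv⟩ := hk₀ (max j k₀) (le_max_right _ _)
  generalize max j k₀ = k at hjk v hv
  have hv' : ∀ (t : I) (x : S.Limit), ‖v (t, S.proj k x) - e (H (t, x))‖ < δ / 6 := fun t x => by
    rw [← dist_eq_norm]
    exact hv (t, x)
  have hbond : ∀ x, S.bond hjk (S.proj k x) = S.proj j x :=
    DFunLike.congr_fun (S.bond_comp_proj hjk)
  have hHm : ∀ t : I, H (t, S.basePoint) = g₀ (S.m j) := fun t => H.eq_fst t rfl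
  have hg01 : g₁ (S.m j) = g₀ (S.m j) := (H.fst_eq_snd rfl).symm
  let w : I × S.M k → ι → ℝ := fun tz => v tz + (e (g₀ (S.m j)) - v (tz.1, S.m k))
  have hwc : Continuous w := by fun_prop
  have hwm : ∀ t, w (t, S.m k) = e (g₀ (S.m j)) := fun t => by simp [w]
  have hw : ∀ (t : I) (x : S.Limit), ‖w (t, S.proj k x) - e (H (t, x))‖ < δ / 3 := fun t x => by
    have h2 := hv' t S.basePoint
    rw [hHm, norm_sub_rev] at h2
    calc ‖w (t, S.proj k x) - e (H (t, x))‖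
        = ‖(v (t, S.proj k x) - e (H (t, x))) + (e (g₀ (S.m j)) - v (t, S.m k))‖ := by
          congr 1; simp only [w]; abel
      _ ≤ _ := norm_add_le _ _
      _ < δ / 6 + δ / 6 := add_lt_add (hv' t x) h2
      _ = δ / 3 := by ring
  -- Interpolating the errors at times 0 and 1 makes both ends exact; the correction vanishes at the
  -- base-point.
  let W : I × S.M k → ι → ℝ := fun tz => w tz +
    ((1 - (tz.1 : ℝ)) • (e (g₀ (S.bond hjk tz.2)) - w (0, tz.2)) +
      (tz.1 : ℝ) • (e (g₁ (S.bond hjk tz.2)) - w (1, tz.2)))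
  have hWc : Continuous W := by fun_prop
  have hW : ∀ tz, W tz ∈ thickening δ (range e) := by
    rintro ⟨t, z⟩
    obtain ⟨x, rfl⟩ := S.proj_surjective k z
    refine mem_thickening_iff.2 ⟨e (H (t, x)), ⟨_, rfl⟩, ?_⟩
    have h0 := hw 0 x
    have h1 := hw 1 x
    rw [H.apply_zero, norm_sub_rev] at h0
    rw [H.apply_one, norm_sub_rev] at h1
    simp only [ContinuousMap.comp_apply] at h0 h1
    rw [dist_eq_norm]
    simp only [W, hbond]
    have ht0 : (0 : ℝ) ≤ t := t.2.1
    have ht1 : (0 : ℝ) ≤ 1 - t := sub_nonneg.2 t.2.2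
    calc _ = ‖(w (t, S.proj k x) - e (H (t, x))) +
          ((1 - (t : ℝ)) • (e (g₀ (S.proj j x)) - w (0, S.proj k x)) +
            (t : ℝ) • (e (g₁ (S.proj j x)) - w (1, S.proj k x)))‖ := by congr 1; abel
      _ ≤ ‖w (t, S.proj k x) - e (H (t, x))‖ +
          (‖(1 - (t : ℝ)) • (e (g₀ (S.proj j x)) - w (0, S.proj k x))‖ +
            ‖(t : ℝ) • (e (g₁ (S.proj j x)) - w (1, S.proj k x))‖) :=
          (norm_add_le _ _).trans (add_le_add_right (norm_add_le _ _) _)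
      _ ≤ ‖w (t, S.proj k x) - e (H (t, x))‖ + ((1 - t) * (δ / 3) + t * (δ / 3)) := by
          rw [norm_smul, norm_smul, Real.norm_of_nonneg ht0, Real.norm_of_nonneg ht1]
          gcongr
      _ < δ / 3 + ((1 - t) * (δ / 3) + t * (δ / 3)) := by gcongr; exact hw t x
      _ = 2 * δ / 3 := by ring
      _ < δ := by linarith
  refine ⟨k, hjk, ⟨⟨⟨⟨r ∘ W, hr.comp_continuous hWc hW⟩, ?_, ?_⟩, ?_⟩⟩⟩
  · intro z
    simp [W, hre]
  · intro z
    simp [W, hre]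
  · rintro t z rfl
    simp [W, hre, hwm, bond_m, hg01]

/-! ### Lifting homotopies through the tower -/

/-- Homotopies relative to the base-point lift through the projections of the solenoid. -/
theorem exists_homotopicRel_lift {i : ℕ} {f : C(S.Limit, S.Limit)} {g : C(S.Limit, S.M i)}
    (hfg : ContinuousMap.HomotopicRel ((S.proj i).comp f) g {S.basePoint}) :
    ∃ f' : C(S.Limit, S.Limit), (S.proj i).comp f' = g ∧
      ContinuousMap.HomotopicRel f f' {S.basePoint} := by
  obtain ⟨H⟩ := hfg
  let K : ∀ k, {K : C(I × S.Limit, S.M (i + k)) // ∀ x, K (0, x) = (f x).1 (i + k)} := fun k =>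
    Nat.rec (motive := fun k => {K : C(I × S.Limit, S.M (i + k)) //
        ∀ x, K (0, x) = (f x).1 (i + k)})
      ⟨H.toContinuousMap, H.apply_zero⟩
      (fun k K => ⟨(S.covering (i + k)).liftHomotopy K.1 ((S.proj (i + k + 1)).comp f)
        fun x => (K.2 x).trans ((f x).2 (i + k)).symm,
        (S.covering (i + k)).liftHomotopy_zero _ _ _⟩) k
  have hK : ∀ k tx, S.p (i + k) ((K (k + 1)).1 tx) = (K k).1 tx := fun k tx =>
    congr_fun ((S.covering (i + k)).liftHomotopy_lifts (K k).1 ((S.proj (i + k + 1)).comp f)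
      fun x => ((K k).2 x).trans ((f x).2 (i + k)).symm) tx
  have hKm : ∀ k t, (K k).1 (t, S.basePoint) = (f S.basePoint).1 (i + k) := fun k => by
    induction k with
    | zero => exact fun t => H.eq_fst t rfl
    | succ k ih =>
      -- Uniqueness of lifts: the track of the base-point lifts a constant path, so it is constant.
      refine congr_fun ((S.covering (i + k)).eq_of_comp_eq (g₁ := fun t : I =>
        (K (k + 1)).1 (t, S.basePoint)) (g₂ := fun _ => (f S.basePoint).1 (i + (k + 1)))
        (by fun_prop) continuous_const (funext fun t => ?_) 0 ((K (k + 1)).2 _))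
      exact (hK k _).trans ((ih t).trans ((f S.basePoint).2 (i + k)).symm)
  let L : C(I × S.Limit, S.Limit) :=
    ⟨fun tx => S.ofTail i (fun k => (K k).1 tx) fun k => hK k tx, Continuous.subtype_mk
      (continuous_pi fun k => (S.bond _).continuous.comp (K k).1.continuous) _⟩
  refine ⟨L.comp ((ContinuousMap.const _ 1).prodMk (ContinuousMap.id _)), ?_,
    ⟨⟨⟨L, fun x => ?_, fun x => rfl⟩, ?_⟩⟩⟩
  · ext x
    exact (S.ofTail_apply_self (y := fun k => (K k).1 (1, x)) fun k => hK k (1, x)).trans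
      (H.apply_one x)
  · exact S.ofTail_eq (fun k => hK k (0, x)) _ fun k => (K k).2 x
  · rintro t x rfl
    exact S.ofTail_eq (fun k => hK k (t, S.basePoint)) _ fun k => hKm k t

/-- A base-point preserving self-map of the solenoid is homotopic to the lifted map of a bundle
morphism to any prescribed projection. -/
theorem exists_bundleMorphism (i : ℕ) (f : C(S.Limit, S.Limit)) (hf : f S.basePoint = S.basePoint) :
    ∃ (j : ℕ) (F : S.BundleMorphism j i), ContinuousMap.HomotopicRel f F.lift {S.basePoint} := by
  obtain ⟨j, g, hg⟩ := S.exists_homotopicRel_comp_proj ((S.proj i).comp f)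
  obtain ⟨f', hf', hff'⟩ := S.exists_homotopicRel_lift hg
  exact ⟨j, ⟨f', g, hf', (hff'.fst_eq_snd rfl).symm.trans hf⟩, hff'⟩

end Solenoid

theorem theorem2p4 (S : Solenoid.{u}) (h : S.Limit ≃ₜ S.Limit)
    (hh : h S.basePoint = S.basePoint) :
    ∃ (j i : ℕ) (F : S.BundleMorphism j i), F.IsAutomorphism ∧
      ContinuousMap.HomotopicRel (h : C(S.Limit, S.Limit)) F.lift {S.basePoint} := by
  -- Target stage 0 makes the index condition `k ≤ j` automatic.
  obtain ⟨i, G, hG⟩ := S.exists_bundleMorphism 0 (h.symm : C(S.Limit, S.Limit))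
    (by simpa using (h.symm_apply_eq.2 hh.symm))
  obtain ⟨j, F, hF⟩ := S.exists_bundleMorphism i (h : C(S.Limit, S.Limit)) hh
  obtain ⟨H⟩ := hF
  obtain ⟨H'⟩ := hG
  have key : ContinuousMap.HomotopicRel ((G.base.comp F.base).comp (S.proj j))
      ((S.bond (Nat.zero_le j)).comp (S.proj j)) {S.basePoint} := by
    have h1 : ContinuousMap.HomotopicRel ((S.proj 0).comp (G.lift.comp (h : C(S.Limit, S.Limit))))
        ((S.proj 0).comp (G.lift.comp F.lift)) {S.basePoint} :=
      ⟨(H.compContinuousMap G.lift).compContinuousMap (S.proj 0)⟩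
    have h2 : ContinuousMap.HomotopicRel (S.proj 0)
        ((S.proj 0).comp (G.lift.comp (h : C(S.Limit, S.Limit)))) {S.basePoint} := by
      refine ⟨⟨⟨(S.proj 0).comp (H'.toContinuousMap.comp
        ((ContinuousMap.id I).prodMap (h : C(S.Limit, S.Limit)))), fun x => ?_, fun x => ?_⟩,
        ?_⟩⟩
      · change S.proj 0 (H' (0, h x)) = _
        simp
      · change S.proj 0 (H' (1, h x)) = _
        simp
      · rintro t x rfl
        change S.proj 0 (H' (t, h S.basePoint)) = _
        rw [hh, H'.eq_fst t rfl]
        exact congr_arg (S.proj 0) (h.symm_apply_eq.2 hh.symm)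
    have h3 : (S.proj 0).comp (G.lift.comp F.lift) = (G.base.comp F.base).comp (S.proj j) := by
      rw [← ContinuousMap.comp_assoc, G.comm, ContinuousMap.comp_assoc, F.comm,
        ContinuousMap.comp_assoc]
    rw [S.bond_comp_proj, ← h3]
    exact (h2.trans h1).symm
  obtain ⟨k, hjk, hk⟩ := S.exists_homotopicRel_comp_bond key
  -- Moving to stage `k` changes only the base-map, so the homotopy `H` from `h` still serves.
  refine ⟨k, i, ⟨F.lift, F.base.comp (S.bond hjk), ?_, F.lift_basePoint⟩,
    ⟨0, Nat.zero_le k, G, ?_⟩, ⟨H⟩⟩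
  · rw [F.comm, ContinuousMap.comp_assoc, S.bond_comp_proj]
  · have hbond : (S.bond (Nat.zero_le j)).comp (S.bond hjk) = S.bond (Nat.zero_le k) := by
      ext y
      obtain ⟨x, rfl⟩ := S.proj_surjective k y
      have h1 := DFunLike.congr_fun (S.bond_comp_proj hjk) x
      have h2 := DFunLike.congr_fun (S.bond_comp_proj (Nat.zero_le j)) x
      have h3 := DFunLike.congr_fun (S.bond_comp_proj (Nat.zero_le k)) x
      simp only [ContinuousMap.comp_apply] at h1 h2 h3 ⊢
      rw [h1, h2, h3]
    rw [hbond] at hk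
    exact hk
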